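/- Let $\mathbb D=\{z\in\mathbb C:|z|<1\}$ and let $0<\lambda<1$. The Hardy space $H^2$ consists of the analytic functions $f$ on $\mathbb D$ with $\sup_{0<r<1}\frac1{2\pi}\int_0^{2\pi}|f(re^{i\theta})|^2\,d\theta<\infty$; such an $f$ has radial limits $f(\zeta)=\lim_{r\to1^-}f(r\zeta)$ at almost every $\zeta\in\partial\mathbb D$. The analytic Morrey space $\mathcal L^{2,\lambda}$ consists of all $f\in H^2$ with $$\sup_{I\subset\partial\mathbb D}\Big(\frac1{|I|^\lambda}\int_I|f(\zeta)-f_I|^2\,\frac{|d\zeta|}{2\pi}\Big)^{1/2}<\infty,$$ where $I$ runs over the arcs of $\partial\mathbb D$ of positive length, $|I|=\frac1{2\pi}\int_I|d\zeta|$ and $f_I=\frac1{|I|}\int_I f(\zeta)\,\frac{|d\zeta|}{2\pi}$. The Bloch space $B$ consists of all analytic functions $f$ on $\mathbb D$ with $\sup_{z\in\mathbb D}(1-|z|^2)|f'(z)|<\infty$. Then $\mathcal L^{2,\lambda}\nsubseteq B$. More precisely, the function $g(z)=\big(\log\frac1{1-z}\big)^2$ (principal branch of the logarithm) belongs to $\mathcal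 L^{2,\lambda}$ but not to $B$. -/

import Mathlib

open Set Filter Topology MeasureTheory

noncomputable section

/-- The open unit disc `𝔻` in `ℂ`. -/
def unitDisc : Set ℂ := Metric.ball 0 1

/-- The Hardy space `H²`: functions analytic on the unit disc whose quadratic means
`(1 / 2π) ∫₀^{2π} |f (r e^{iθ})|² dθ` are bounded uniformly in `0 < r < 1`. -/
def hardyTwo : Set (ℂ → ℂ) :=
  {f | DifferentiableOn ℂ f unitDisc ∧
    ∃ M : ℝ, ∀ r ∈ Ioo (0 : ℝ) 1,
      1 / (2 * Real.pi) * ∫ θ in (0 : ℝ)..(2 * Real.pi), ‖f (circleMap 0 r θ)‖ ^ 2 ≤ M}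

/-- The boundary value of `f` at `e^{iθ}`, that is, the radial limit `lim_{r → 1⁻} f (r e^{iθ})`.
For `f ∈ H²` this limit exists for almost every `θ` (Fatou), and the value chosen on the
exceptional null set plays no role below. -/
def boundaryValue (f : ℂ → ℂ) (θ : ℝ) : ℂ :=
  limUnder (𝓝[<] (1 : ℝ)) (fun r : ℝ => f (circleMap 0 r θ))

/-- The normalized length `|I|` of the arc `I = {e^{iθ} : a ≤ θ ≤ b}`, `a < b ≤ a + 2π`. -/
def arcLength (a b : ℝ) : ℝ := (b - a) / (2 * Real.pi)

/-- The mean `f_I = (1 / |I|) ∫_I f(ζ) |dζ| / 2π` over the arc `I = {e^{iθ} : a ≤ θ ≤ b}`. -/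
def arcMean (f : ℂ → ℂ) (a b : ℝ) : ℂ :=
  ((1 / arcLength a b : ℝ) : ℂ) * ∫ θ in a..b, boundaryValue f θ / (2 * Real.pi)

/-- The Morrey seminorm `sup_I ( |I|^{-lam} ∫_I |f(ζ) - f_I|² |dζ| / 2π )^{1/2}`, in `[0, ∞]`;
the supremum runs over all arcs `I` of the unit circle, the full circle included. -/
def morreySeminorm (lam : ℝ) (f : ℂ → ℂ) : ENNReal :=
  ⨆ (a : ℝ) (b : ℝ) (_ : a < b) (_ : b ≤ a + 2 * Real.pi),
    (ENNReal.ofReal (1 / arcLength a b ^ lam) *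
      ∫⁻ θ in Icc a b,
        ENNReal.ofReal (‖boundaryValue f θ - arcMean f a b‖ ^ 2 / (2 * Real.pi))) ^ (1 / 2 : ℝ)

/-- The analytic Morrey space `𝓛^{2,lam}` of the unit disc. -/
def analyticMorrey (lam : ℝ) : Set (ℂ → ℂ) :=
  {f | f ∈ hardyTwo ∧ morreySeminorm lam f < ⊤}

/-- The Bloch space `B`: functions analytic on the unit disc with
`sup_{z ∈ 𝔻} (1 - |z|²) |f'(z)| < ∞`. -/
def blochSpace : Set (ℂ → ℂ) :=
  {f | DifferentiableOn ℂ f unitDisc ∧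
    BddAbove ((fun z : ℂ => (1 - ‖z‖ ^ 2) * ‖deriv f z‖) '' unitDisc)}

end

/-! The only singularity of `g` on the closed disc is at `1`, and it is logarithmic: for every `p >
0`, `|g(re^{iθ})| ≤ K |1 - e^{iθ}|^{-p}` uniformly in `0 < r ≤ 1`
(`exists_norm_log_one_div_one_sub_sq_le`). By `exists_setLIntegral_le_of_le_norm_one_sub_exp`, the
square of such a bound integrates to `O(|I|^{1-2p})` over an arc `I` as soon as `2p < 1`. Taking `p
= 1/4` gives `g ∈ H²`, and `p = (1 - λ)/2` gives exactly `O(|I|^λ)`. No cancellation between `g` and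
its mean is needed, since the two are bounded separately.

On the real axis `(1 - x²) g'(x) = 2(1 + x) log(1/(1 - x))`, which is unbounded as `x → 1⁻`, so `g`
is not Bloch. -/

/-- The integral of `|x - c| ^ (-s)` over a segment of length `L` is `O(L ^ (1 - s))`,
uniformly in `c`. -/
theorem setLIntegral_Icc_abs_sub_rpow_neg_le {s : ℝ} (hs0 : 0 ≤ s) (hs1 : s < 1) {a b : ℝ}
    (hab : a < b) (c : ℝ) :
    ∫⁻ x in Icc a b, ENNReal.ofReal (|x - c| ^ (-s)) ≤
      ENNReal.ofReal ((2 / (1 - s) + 1) * (b - a) ^ (1 - s)) := by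
  obtain ⟨L, hL⟩ : ∃ L, L = b - a := ⟨_, rfl⟩
  rw [← hL]
  have hL0 : 0 < L := by linarith
  have hs : -1 < -s := by linarith
  have hval : ∫ x in (0 : ℝ)..L, x ^ (-s) = L ^ (1 - s) / (1 - s) := by
    rw [integral_rpow (Or.inl hs), Real.zero_rpow (by linarith)]
    ring_nf
  have hint : IntervalIntegrable (fun x : ℝ => x ^ (-s)) volume 0 L :=
    intervalIntegral.intervalIntegrable_rpow' hs
  have hright : ∫⁻ x in Ioc c (c + L), ENNReal.ofReal (|x - c| ^ (-s)) =
      ENNReal.ofReal (L ^ (1 - s) / (1 - s)) := by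
    have hi : IntervalIntegrable (fun x : ℝ => (x - c) ^ (-s)) volume c (c + L) := by
      have := hint.comp_sub_right c
      rwa [zero_add, add_comm L c] at this
    have hv : ∫ x in c..(c + L), (x - c) ^ (-s) = L ^ (1 - s) / (1 - s) := by
      rw [intervalIntegral.integral_comp_sub_right (fun x : ℝ => x ^ (-s)) c]
      simp [hval]
    rw [← hv, intervalIntegral.integral_of_le (by linarith),
      ofReal_integral_eq_lintegral_ofReal hi.1]
    · refine setLIntegral_congr_fun measurableSet_Ioc fun x hx => ?_
      rw [abs_of_pos (sub_pos.2 hx.1)]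
    · refine (ae_restrict_iff' measurableSet_Ioc).2 (Eventually.of_forall fun x hx => ?_)
      exact Real.rpow_nonneg (sub_nonneg.2 hx.1.le) _
  have hleft : ∫⁻ x in Ioc (c - L) c, ENNReal.ofReal (|x - c| ^ (-s)) =
      ENNReal.ofReal (L ^ (1 - s) / (1 - s)) := by
    have hi : IntervalIntegrable (fun x : ℝ => (c - x) ^ (-s)) volume (c - L) c := by
      have := (hint.comp_sub_left c).symm
      rwa [sub_zero] at this
    have hv : ∫ x in (c - L)..c, (c - x) ^ (-s) = L ^ (1 - s) / (1 - s) := by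
      rw [intervalIntegral.integral_comp_sub_left (fun x : ℝ => x ^ (-s)) c]
      simp [hval]
    rw [← hv, intervalIntegral.integral_of_le (by linarith),
      ofReal_integral_eq_lintegral_ofReal hi.1]
    · refine setLIntegral_congr_fun measurableSet_Ioc fun x hx => ?_
      rw [abs_sub_comm, abs_of_nonneg (sub_nonneg.2 hx.2)]
    · refine (ae_restrict_iff' measurableSet_Ioc).2 (Eventually.of_forall fun x hx => ?_)
      exact Real.rpow_nonneg (sub_nonneg.2 hx.2) _
  -- Points within `L` of `c` lie in two intervals where the integral is explicit; elsewhere the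
  -- integrand is at most `L ^ (-s)` on a set of measure at most `L`.
  have hsub : Icc a b ⊆ (Ioc (c - L) c ∪ Ioc c (c + L)) ∪ {x ∈ Icc a b | L ≤ |x - c|} := by
    intro x hx
    by_cases h : L ≤ |x - c|
    · exact Or.inr ⟨hx, h⟩
    · have h' := abs_lt.1 (not_le.1 h)
      rcases le_or_gt x c with hc | hc
      · exact Or.inl (Or.inl ⟨by linarith [h'.1], hc⟩)
      · exact Or.inl (Or.inr ⟨hc, by linarith [h'.2]⟩)
  have hfar : ∫⁻ x in {x ∈ Icc a b | L ≤ |x - c|}, ENNReal.ofReal (|x - c| ^ (-s)) ≤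
      ENNReal.ofReal (L ^ (1 - s)) := by
    calc ∫⁻ x in {x ∈ Icc a b | L ≤ |x - c|}, ENNReal.ofReal (|x - c| ^ (-s))
        ≤ ∫⁻ _ in {x ∈ Icc a b | L ≤ |x - c|}, ENNReal.ofReal (L ^ (-s)) := by
          refine setLIntegral_mono measurable_const fun x hx => ENNReal.ofReal_le_ofReal ?_
          exact Real.rpow_le_rpow_of_nonpos hL0 hx.2 (by linarith)
      _ ≤ ENNReal.ofReal (L ^ (-s)) * volume (Icc a b) := by
          rw [setLIntegral_const]
          gcongr
          exact fun x hx => hx.1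
      _ = ENNReal.ofReal (L ^ (1 - s)) := by
          rw [Real.volume_Icc, ← hL, ← ENNReal.ofReal_mul (by positivity),
            show (1 : ℝ) - s = -s + 1 by ring, Real.rpow_add_one hL0.ne']
  have h1 : 0 < 1 - s := by linarith
  calc ∫⁻ x in Icc a b, ENNReal.ofReal (|x - c| ^ (-s))
      ≤ _ := lintegral_mono_set hsub
    _ ≤ _ := lintegral_union_le _ _ _
    _ ≤ _ := add_le_add (lintegral_union_le _ _ _) hfar
    _ = ENNReal.ofReal ((2 / (1 - s) + 1) * L ^ (1 - s)) := by
        rw [hleft, hright, ← ENNReal.ofReal_add (by positivity) (by positivity),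
          ← ENNReal.ofReal_add (by positivity) (by positivity)]
        congr 1
        ring

/-- The chord is `2 |sin (x / 2)|`, so this is Jordan's inequality. -/
theorem two_div_pi_mul_abs_le_norm_one_sub_exp {x : ℝ} (hx : |x| ≤ Real.pi) :
    2 / Real.pi * |x| ≤ ‖1 - Complex.exp (x * Complex.I)‖ := by
  have h1 : ‖1 - Complex.exp (x * Complex.I)‖ = 2 * |Real.sin (x / 2)| := by
    rw [norm_sub_rev, mul_comm, Complex.norm_exp_I_mul_ofReal_sub_one]
    simp
  have h2 := Real.mul_abs_le_abs_sin (x := x / 2) (by rw [abs_div]; norm_num; linarith)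
  rw [h1]
  rw [abs_div, abs_two] at h2
  linarith

/-- A function on an arc of length `L ≤ 2π` that is `O(|1 - e^{iθ}| ^ (-s))` has
integral `O(L ^ (1 - s))`. -/
theorem exists_setLIntegral_le_of_le_norm_one_sub_exp {s K : ℝ} (hs0 : 0 ≤ s) (hs1 : s < 1)
    (hK : 0 ≤ K) :
    ∃ C : ℝ, 0 ≤ C ∧ ∀ h : ℝ → ℝ,
      (∀ θ : ℝ, Complex.exp (θ * Complex.I) ≠ 1 →
        h θ ≤ K * ‖1 - Complex.exp (θ * Complex.I)‖ ^ (-s)) →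
      ∀ a b : ℝ, a < b → b ≤ a + 2 * Real.pi →
        ∫⁻ θ in Icc a b, ENNReal.ofReal (h θ) ≤ ENNReal.ofReal (C * (b - a) ^ (1 - s)) := by
  have hpi := Real.pi_pos
  have h1s : 0 < 1 - s := by linarith
  obtain ⟨A, hA⟩ : ∃ A, A = K * (2 / Real.pi) ^ (-s) := ⟨_, rfl⟩
  have hA0 : 0 ≤ A := by rw [hA]; positivity
  refine ⟨2 * A * (2 / (1 - s) + 1), by positivity, fun h hh a b hab hba => ?_⟩
  -- With `2πk` the multiple of `2π` nearest to `a`, the arc lies in `[2πk - π, 2πk + 3π]`, so each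
  -- of its points is within `π` of `2πk` or `2π(k + 1)`.
  obtain ⟨k, hk⟩ : ∃ k : ℤ, |a / (2 * Real.pi) - k| ≤ 1 / 2 := ⟨round _, abs_sub_round _⟩
  have hk' : |a - 2 * Real.pi * k| ≤ Real.pi := by
    have : a - 2 * Real.pi * k = (a / (2 * Real.pi) - k) * (2 * Real.pi) := by field_simp
    rw [this, abs_mul, abs_of_pos (show 0 < 2 * Real.pi by positivity)]
    nlinarith
  have hk1 := abs_le.1 hk'
  have key : ∀ (θ : ℝ) (n : ℤ), |θ - 2 * Real.pi * n| ≤ Real.pi → θ ≠ 2 * Real.pi * n →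
      h θ ≤ A * |θ - 2 * Real.pi * n| ^ (-s) := by
    intro θ n hn hne
    have hexp : Complex.exp (((θ - 2 * Real.pi * n : ℝ) : ℂ) * Complex.I) =
        Complex.exp (θ * Complex.I) := by
      rw [Complex.exp_eq_exp_iff_exists_int]
      exact ⟨-n, by push_cast; ring⟩
    have hlow := two_div_pi_mul_abs_le_norm_one_sub_exp hn
    rw [hexp] at hlow
    have hpos : 0 < |θ - 2 * Real.pi * n| := abs_pos.2 (sub_ne_zero.2 hne)
    have hpos' : 0 < 2 / Real.pi * |θ - 2 * Real.pi * n| := by positivity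
    refine (hh θ fun he => ?_).trans ?_
    · rw [he, sub_self, norm_zero] at hlow
      linarith
    · rw [hA, mul_assoc, ← Real.mul_rpow (by positivity) (abs_nonneg _)]
      exact mul_le_mul_of_nonneg_left
        (Real.rpow_le_rpow_of_nonpos hpos' hlow (by linarith)) hK
  -- Only almost everywhere: nothing is known about `h` at the singular points themselves.
  have hae : ∀ᵐ θ : ℝ ∂volume.restrict (Icc a b), ENNReal.ofReal (h θ) ≤
      ENNReal.ofReal A * ENNReal.ofReal (|θ - 2 * Real.pi * k| ^ (-s)) +
      ENNReal.ofReal A * ENNReal.ofReal (|θ - 2 * Real.pi * (k + 1 : ℤ)| ^ (-s)) := by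
    rw [ae_restrict_iff' measurableSet_Icc]
    filter_upwards [Measure.ae_ne volume (2 * Real.pi * k),
      Measure.ae_ne volume (2 * Real.pi * (k + 1 : ℤ))] with θ h0 h1 hθ
    rw [← ENNReal.ofReal_mul hA0, ← ENNReal.ofReal_mul hA0]
    rcases le_total θ (2 * Real.pi * k + Real.pi) with hc | hc
    · refine le_add_right (ENNReal.ofReal_le_ofReal (key θ k ?_ h0))
      rw [abs_le]
      constructor <;> linarith [hθ.1]
    · refine le_add_left (ENNReal.ofReal_le_ofReal (key θ (k + 1) ?_ h1))
      rw [abs_le]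
      push_cast
      constructor <;> linarith [hθ.2]
  have hL : 0 ≤ b - a := by linarith
  calc ∫⁻ θ in Icc a b, ENNReal.ofReal (h θ) ≤ _ := lintegral_mono_ae hae
    _ = ENNReal.ofReal A * (∫⁻ θ in Icc a b, ENNReal.ofReal (|θ - 2 * Real.pi * k| ^ (-s))) +
        ENNReal.ofReal A *
          ∫⁻ θ in Icc a b, ENNReal.ofReal (|θ - 2 * Real.pi * (k + 1 : ℤ)| ^ (-s)) := by
        rw [lintegral_add_left (by fun_prop), lintegral_const_mul _ (by fun_prop),
          lintegral_const_mul _ (by fun_prop)]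
    _ ≤ ENNReal.ofReal A * ENNReal.ofReal ((2 / (1 - s) + 1) * (b - a) ^ (1 - s)) +
        ENNReal.ofReal A * ENNReal.ofReal ((2 / (1 - s) + 1) * (b - a) ^ (1 - s)) := by
        gcongr <;> exact setLIntegral_Icc_abs_sub_rpow_neg_le hs0 hs1 hab _
    _ = _ := by
        rw [← ENNReal.ofReal_mul hA0, ← ENNReal.ofReal_add (by positivity) (by positivity)]
        congr 1
        ring

/-! ### Growth and derivative of the squared logarithm -/

theorem exists_norm_log_le_rpow_neg {ε : ℝ} (hε : 0 < ε) :
    ∃ K : ℝ, 0 ≤ K ∧ ∀ w : ℂ, w ≠ 0 → ‖w‖ ≤ 2 → ‖Complex.log w‖ ≤ K * ‖w‖ ^ (-ε) := by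
  have hpi := Real.pi_pos
  -- The terms absorb `x ^ ε / ε`, `x ^ (-ε) / ε` and the argument bound `π`; the first and last use
  -- `x ≤ 2`.
  refine ⟨2 ^ (2 * ε) / ε + 1 / ε + Real.pi * 2 ^ ε, by positivity, fun w hw hw2 => ?_⟩
  have hx : 0 < ‖w‖ := norm_pos_iff.2 hw
  have h1 : ‖Complex.log w‖ ≤ |Real.log ‖w‖| + Real.pi := by
    refine (Complex.norm_le_abs_re_add_abs_im _).trans ?_
    rw [Complex.log_re, Complex.log_im]
    gcongr
    exact Complex.abs_arg_le_pi w
  generalize ‖w‖ = x at *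
  have hlog : |Real.log x| ≤ x ^ ε / ε + x ^ (-ε) / ε := by
    have hp : 0 ≤ x ^ ε / ε := by positivity
    have hn : 0 ≤ x ^ (-ε) / ε := by positivity
    have hu := Real.log_le_rpow_div hx.le hε
    have hl := Real.log_le_rpow_div (inv_nonneg.2 hx.le) hε
    rw [Real.log_inv, Real.inv_rpow hx.le, ← Real.rpow_neg hx.le] at hl
    rw [abs_le]
    constructor <;> linarith
  have hxn : 0 < x ^ (-ε) := by positivity
  have hsplit : x ^ ε = x ^ (2 * ε) * x ^ (-ε) := by
    rw [← Real.rpow_add hx]; ring_nf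
  have h2 : x ^ ε ≤ 2 ^ (2 * ε) * x ^ (-ε) := by
    rw [hsplit]
    gcongr
  have h3 : 1 ≤ 2 ^ ε * x ^ (-ε) := by
    rw [Real.rpow_neg hx.le, ← div_eq_mul_inv, one_le_div (by positivity)]
    gcongr
  calc ‖Complex.log w‖ ≤ x ^ ε / ε + x ^ (-ε) / ε + Real.pi * 1 := by linarith
    _ ≤ 2 ^ (2 * ε) * x ^ (-ε) / ε + x ^ (-ε) / ε + Real.pi * (2 ^ ε * x ^ (-ε)) := by gcongr
    _ = _ := by ring

theorem one_sub_mem_slitPlane {z : ℂ} (hz : ‖z‖ ≤ 1) (hz1 : z ≠ 1) :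
    1 - z ∈ Complex.slitPlane := by
  have hre : z.re < 1 := by
    refine lt_of_le_of_ne ((Complex.re_le_norm z).trans hz) fun h => hz1 ?_
    have h2 := Complex.sq_norm z
    rw [Complex.normSq_apply, h] at h2
    have h3 : z.im = 0 := by nlinarith [norm_nonneg z]
    exact Complex.ext (by simpa using h) (by simpa using h3)
  exact Or.inl (by simpa using hre)

theorem log_one_div_one_sub {z : ℂ} (hz : ‖z‖ ≤ 1) (hz1 : z ≠ 1) :
    Complex.log (1 / (1 - z)) = -Complex.log (1 - z) := by
  rw [one_div, Complex.log_inv _ (Complex.slitPlane_arg_ne_pi (one_sub_mem_slitPlane hz hz1))]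

/-- Covering the closed disc minus `1` also gives continuity at boundary points, which turns radial
limits into values. -/
theorem hasDerivAt_log_one_div_one_sub_sq {z : ℂ} (hz : ‖z‖ ≤ 1) (hz1 : z ≠ 1) :
    HasDerivAt (fun z : ℂ => Complex.log (1 / (1 - z)) ^ 2)
      (2 * Complex.log (1 / (1 - z)) / (1 - z)) z := by
  have h1 : HasDerivAt (fun z : ℂ => Complex.log (1 - z) ^ 2)
      (2 * Complex.log (1 / (1 - z)) / (1 - z)) z := by
    refine ((((hasDerivAt_id' z).const_sub 1).clog (one_sub_mem_slitPlane hz hz1)).pow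
      2).congr_deriv ?_
    rw [log_one_div_one_sub hz hz1]
    simp only [Nat.cast_ofNat, Nat.add_one_sub_one, pow_one]
    ring
  have hev : (fun z : ℂ => Complex.log (1 / (1 - z)) ^ 2) =ᶠ[𝓝 z]
      fun z : ℂ => Complex.log (1 - z) ^ 2 := by
    have hc : ContinuousAt (fun z : ℂ => 1 - z) z := by fun_prop
    filter_upwards [hc (Complex.isOpen_slitPlane.mem_nhds (one_sub_mem_slitPlane hz hz1))]
      with w hw
    rw [one_div, Complex.log_inv _ (Complex.slitPlane_arg_ne_pi hw), neg_sq]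
  exact h1.congr_of_eventuallyEq hev

theorem ne_one_of_mem_unitDisc {z : ℂ} (hz : z ∈ unitDisc) : ‖z‖ ≤ 1 ∧ z ≠ 1 := by
  have h : ‖z‖ < 1 := by simpa [unitDisc] using hz
  refine ⟨h.le, fun h1 => ?_⟩
  rw [h1, norm_one] at h
  exact lt_irrefl _ h

theorem differentiableOn_log_one_div_one_sub_sq :
    DifferentiableOn ℂ (fun z : ℂ => Complex.log (1 / (1 - z)) ^ 2) unitDisc := fun _ hz =>
  (hasDerivAt_log_one_div_one_sub_sq (ne_one_of_mem_unitDisc hz).1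
    (ne_one_of_mem_unitDisc hz).2).differentiableAt.differentiableWithinAt

theorem exists_norm_log_one_div_one_sub_sq_le {p : ℝ} (hp : 0 < p) :
    ∃ K : ℝ, 0 ≤ K ∧ ∀ r ∈ Ioc (0 : ℝ) 1, ∀ θ : ℝ, Complex.exp (θ * Complex.I) ≠ 1 →
      ‖Complex.log (1 / (1 - circleMap 0 r θ)) ^ 2‖ ≤
        K * ‖1 - Complex.exp (θ * Complex.I)‖ ^ (-p) := by
  obtain ⟨K, hK, hlog⟩ := exists_norm_log_le_rpow_neg (half_pos hp)
  refine ⟨K ^ 2 * (1 / 2) ^ (-p), by positivity, fun r hr θ hθ => ?_⟩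
  obtain ⟨e, he⟩ : ∃ e, e = Complex.exp (θ * Complex.I) := ⟨_, rfl⟩
  have hne : ‖e‖ = 1 := by rw [he, Complex.norm_exp_ofReal_mul_I]
  have hc : circleMap 0 r θ = r * e := by simp [circleMap, he]
  rw [← he] at hθ ⊢
  rw [hc]
  have hre : ‖(r : ℂ) * e‖ = r := by
    rw [norm_mul, hne, Complex.norm_real, Real.norm_of_nonneg hr.1.le, mul_one]
  have hd : 0 < ‖1 - e‖ := norm_pos_iff.2 (sub_ne_zero.2 hθ.symm)
  -- Uniformity in `r`: moving from `e` to `re` costs `1 - r`, itself at most `|1 - re|`.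
  have hlow : 1 / 2 * ‖1 - e‖ ≤ ‖1 - (r : ℂ) * e‖ := by
    have h1 : ‖1 - e‖ ≤ ‖1 - (r : ℂ) * e‖ + (1 - r) := by
      calc ‖1 - e‖ = ‖(1 - (r : ℂ) * e) - ((1 - r : ℝ) : ℂ) * e‖ := by
            congr 1; push_cast; ring
        _ ≤ ‖1 - (r : ℂ) * e‖ + ‖((1 - r : ℝ) : ℂ) * e‖ := norm_sub_le _ _
        _ = _ := by
            rw [norm_mul, hne, Complex.norm_real, Real.norm_of_nonneg (by linarith [hr.2]),
              mul_one]
    have h2 : 1 - r ≤ ‖1 - (r : ℂ) * e‖ := by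
      have := norm_sub_norm_le (1 : ℂ) (r * e)
      rwa [hre, norm_one] at this
    linarith
  have hw0 : 1 - (r : ℂ) * e ≠ 0 := norm_pos_iff.1 (lt_of_lt_of_le (by positivity) hlow)
  have hw2 : ‖1 - (r : ℂ) * e‖ ≤ 2 := by
    refine (norm_sub_le _ _).trans ?_
    rw [hre, norm_one]
    linarith [hr.2]
  rw [log_one_div_one_sub (by rw [hre]; exact hr.2) fun h => hw0 (by rw [h, sub_self]), neg_sq,
    norm_pow]
  calc ‖Complex.log (1 - r * e)‖ ^ 2 ≤ (K * ‖1 - (r : ℂ) * e‖ ^ (-(p / 2))) ^ 2 := by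
        gcongr
        exact hlog _ hw0 hw2
    _ = K ^ 2 * ‖1 - (r : ℂ) * e‖ ^ (-p) := by
        rw [mul_pow, ← Real.rpow_mul_natCast (norm_nonneg _)]
        congr 2
        push_cast
        ring
    _ ≤ K ^ 2 * (1 / 2 * ‖1 - e‖) ^ (-p) := by
        exact mul_le_mul_of_nonneg_left
          (Real.rpow_le_rpow_of_nonpos (by positivity) hlow (by linarith)) (by positivity)
    _ = _ := by rw [Real.mul_rpow (by positivity) (norm_nonneg _), mul_assoc]

theorem sq_le_of_le_rpow_neg {x K d p : ℝ} (hx : 0 ≤ x) (hd : 0 ≤ d) (h : x ≤ K * d ^ (-p)) :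
    x ^ 2 ≤ K ^ 2 * d ^ (-(2 * p)) := by
  calc x ^ 2 ≤ (K * d ^ (-p)) ^ 2 := by gcongr
    _ = _ := by
        rw [mul_pow, ← Real.rpow_mul_natCast hd]
        congr 2
        push_cast
        ring

/-! ### Membership in the Hardy and Morrey spaces -/

theorem boundaryValue_eq_of_continuousAt {f : ℂ → ℂ} {θ : ℝ}
    (hf : ContinuousAt f (circleMap 0 1 θ)) : boundaryValue f θ = f (circleMap 0 1 θ) := by
  refine Tendsto.limUnder_eq ?_
  have hc : Continuous fun r : ℝ => circleMap 0 r θ := by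
    unfold circleMap
    fun_prop
  exact (hf.tendsto.comp (hc.tendsto 1)).mono_left nhdsWithin_le_nhds

theorem log_one_div_one_sub_sq_mem_hardyTwo :
    (fun z : ℂ => Complex.log (1 / (1 - z)) ^ 2) ∈ hardyTwo := by
  refine ⟨differentiableOn_log_one_div_one_sub_sq, ?_⟩
  have hpi := Real.pi_pos
  obtain ⟨K, hK, hb⟩ := exists_norm_log_one_div_one_sub_sq_le (p := 1 / 4) (by norm_num)
  obtain ⟨C, hC, hint⟩ := exists_setLIntegral_le_of_le_norm_one_sub_exp (s := 2 * (1 / 4))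
    (K := K ^ 2) (by norm_num) (by norm_num) (by positivity)
  refine ⟨1 / (2 * Real.pi) * (C * (2 * Real.pi - 0) ^ (1 - 2 * (1 / 4) : ℝ)),
    fun r hr => ?_⟩
  have hbound : 0 ≤ C * (2 * Real.pi - 0) ^ (1 - 2 * (1 / 4) : ℝ) := by
    rw [sub_zero]; positivity
  have h := hint (fun θ => ‖Complex.log (1 / (1 - circleMap 0 r θ)) ^ 2‖ ^ 2)
    (fun θ hθ => sq_le_of_le_rpow_neg (norm_nonneg _) (norm_nonneg _)
      (hb r ⟨hr.1, hr.2.le⟩ θ hθ)) 0 (2 * Real.pi) (by positivity) (by simp)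
  refine mul_le_mul_of_nonneg_left ?_ (by positivity)
  rw [intervalIntegral.integral_of_le (by positivity), ← integral_Icc_eq_integral_Ioc]
  refine (Real.le_norm_self _).trans ((norm_integral_le_lintegral_norm _).trans ?_)
  refine ENNReal.toReal_le_of_le_ofReal hbound ?_
  simpa only [norm_pow, norm_norm] using h

/-- If the boundary values of `f` are `O(|1 - e^{iθ}| ^ (-(1 - lam) / 2))` then the Morrey
seminorm of `f` is finite. -/
theorem morreySeminorm_lt_top_of_le {lam K : ℝ} (h0 : 0 < lam) (h1 : lam < 1) (hK : 0 ≤ K)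
    {f : ℂ → ℂ}
    (hf : ∀ θ : ℝ, Complex.exp (θ * Complex.I) ≠ 1 →
      ‖boundaryValue f θ‖ ≤ K * ‖1 - Complex.exp (θ * Complex.I)‖ ^ (-((1 - lam) / 2))) :
    morreySeminorm lam f < ⊤ := by
  have hpi := Real.pi_pos
  obtain ⟨p, hp⟩ : ∃ p, p = (1 - lam) / 2 := ⟨_, rfl⟩
  have hp0 : 0 ≤ p := by linarith
  rw [← hp] at hf
  obtain ⟨C, hC, hint⟩ := exists_setLIntegral_le_of_le_norm_one_sub_exp (s := p)
    (K := K) hp0 (by linarith) hK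
  obtain ⟨D, hD, hint2⟩ := exists_setLIntegral_le_of_le_norm_one_sub_exp (s := 2 * p)
    (K := K ^ 2) (by linarith) (by linarith) (by positivity)
  have hlam : 1 - 2 * p = lam := by linarith
  rw [hlam] at hint2
  have hmain : morreySeminorm lam f ≤
      ENNReal.ofReal ((2 * Real.pi) ^ lam * (2 * D + 2 * C ^ 2)) ^ (1 / 2 : ℝ) := by
    refine iSup_le fun a => iSup_le fun b => iSup_le fun hab => iSup_le fun hba => ?_
    refine ENNReal.rpow_le_rpow ?_ (by norm_num)
    obtain ⟨L, hL⟩ : ∃ L, L = b - a := ⟨_, rfl⟩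
    have hL0 : 0 < L := by linarith
    have hI1 := hint (fun θ => ‖boundaryValue f θ‖) hf a b hab hba
    have hI2 := hint2 (fun θ => ‖boundaryValue f θ‖ ^ 2)
      (fun θ hθ => sq_le_of_le_rpow_neg (norm_nonneg _) (norm_nonneg _) (hf θ hθ)) a b hab hba
    rw [← hL] at hI1 hI2
    -- The squared mean is then `O(L ^ (-2p))`; integrated over length `L` it contributes `L ^ (1 -
    -- 2p) = L ^ lam`, the same order as `|f|²`.
    have hmean : ‖arcMean f a b‖ ≤ C * L ^ (-p) := by
      have hi : ‖∫ θ in a..b, boundaryValue f θ‖ ≤ C * L ^ (1 - p) := by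
        rw [intervalIntegral.integral_of_le hab.le, ← integral_Icc_eq_integral_Ioc]
        exact (norm_integral_le_lintegral_norm _).trans
          (ENNReal.toReal_le_of_le_ofReal (by positivity) hI1)
      have hm : arcMean f a b = ((1 / L : ℝ) : ℂ) * ∫ θ in a..b, boundaryValue f θ := by
        rw [arcMean, arcLength, ← hL, intervalIntegral.integral_div]
        have : (Real.pi : ℂ) ≠ 0 := by exact_mod_cast hpi.ne'
        have : (L : ℂ) ≠ 0 := by exact_mod_cast hL0.ne'
        push_cast
        field_simp
      rw [hm, norm_mul, Complex.norm_real, Real.norm_of_nonneg (by positivity)]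
      calc 1 / L * ‖∫ θ in a..b, boundaryValue f θ‖ ≤ 1 / L * (C * L ^ (1 - p)) := by gcongr
        _ = C * L ^ (-p) := by
            rw [show (1 : ℝ) - p = -p + 1 by ring, Real.rpow_add_one hL0.ne']
            field_simp
    have hmean2 : ‖arcMean f a b‖ ^ 2 ≤ C ^ 2 * L ^ (-(2 * p)) :=
      sq_le_of_le_rpow_neg (norm_nonneg _) hL0.le hmean
    have hpt : ∀ θ, ENNReal.ofReal (‖boundaryValue f θ - arcMean f a b‖ ^ 2 / (2 * Real.pi)) ≤
        2 * ENNReal.ofReal (‖boundaryValue f θ‖ ^ 2) +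
          ENNReal.ofReal (2 * (C ^ 2 * L ^ (-(2 * p)))) := by
      intro θ
      rw [show (2 : ENNReal) = ENNReal.ofReal 2 by simp, ← ENNReal.ofReal_mul zero_le_two,
        ← ENNReal.ofReal_add (by positivity) (by positivity)]
      refine ENNReal.ofReal_le_ofReal ?_
      refine (div_le_self (by positivity) (by linarith [Real.pi_gt_three])).trans ?_
      have := norm_sub_le (boundaryValue f θ) (arcMean f a b)
      calc ‖boundaryValue f θ - arcMean f a b‖ ^ 2
          ≤ (‖boundaryValue f θ‖ + ‖arcMean f a b‖) ^ 2 := by gcongr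
        _ ≤ 2 * ‖boundaryValue f θ‖ ^ 2 + 2 * ‖arcMean f a b‖ ^ 2 := by
            nlinarith [sq_nonneg (‖boundaryValue f θ‖ - ‖arcMean f a b‖)]
        _ ≤ _ := by linarith
    have hL2 : L ^ (-(2 * p)) * L = L ^ lam := by
      rw [← Real.rpow_add_one hL0.ne']
      congr 1
      linarith
    have htotal : ∫⁻ θ in Icc a b,
        ENNReal.ofReal (‖boundaryValue f θ - arcMean f a b‖ ^ 2 / (2 * Real.pi)) ≤
        ENNReal.ofReal ((2 * D + 2 * C ^ 2) * L ^ lam) := by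
      calc _ ≤ ∫⁻ θ in Icc a b, (2 * ENNReal.ofReal (‖boundaryValue f θ‖ ^ 2) +
            ENNReal.ofReal (2 * (C ^ 2 * L ^ (-(2 * p))))) := lintegral_mono hpt
        _ = 2 * (∫⁻ θ in Icc a b, ENNReal.ofReal (‖boundaryValue f θ‖ ^ 2)) +
            ENNReal.ofReal (2 * (C ^ 2 * L ^ (-(2 * p)))) * ENNReal.ofReal L := by
            rw [lintegral_add_right _ measurable_const,
              lintegral_const_mul' _ _ ENNReal.ofNat_ne_top, setLIntegral_const,
              Real.volume_Icc, hL]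
        _ ≤ 2 * ENNReal.ofReal (D * L ^ lam) +
            ENNReal.ofReal (2 * (C ^ 2 * L ^ (-(2 * p)))) * ENNReal.ofReal L := by gcongr
        _ = _ := by
            rw [show (2 : ENNReal) = ENNReal.ofReal 2 by simp, ← ENNReal.ofReal_mul zero_le_two,
              ← ENNReal.ofReal_mul (by positivity),
              ← ENNReal.ofReal_add (by positivity) (by positivity), ← hL2]
            congr 1
            ring
    refine (mul_le_mul_right htotal _).trans ?_
    rw [arcLength, ← hL, ← ENNReal.ofReal_mul (by positivity)]
    refine ENNReal.ofReal_le_ofReal (le_of_eq ?_)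
    rw [Real.div_rpow hL0.le (by positivity)]
    have : L ^ lam ≠ 0 := by positivity
    field_simp
  exact hmain.trans_lt (ENNReal.rpow_lt_top_of_nonneg (by norm_num) ENNReal.ofReal_ne_top)

theorem log_one_div_one_sub_sq_mem_analyticMorrey {lam : ℝ} (h0 : 0 < lam) (h1 : lam < 1) :
    (fun z : ℂ => Complex.log (1 / (1 - z)) ^ 2) ∈ analyticMorrey lam := by
  refine ⟨log_one_div_one_sub_sq_mem_hardyTwo, ?_⟩
  obtain ⟨K, hK, hb⟩ := exists_norm_log_one_div_one_sub_sq_le (p := (1 - lam) / 2) (by linarith)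
  refine morreySeminorm_lt_top_of_le h0 h1 hK fun θ hθ => ?_
  rw [boundaryValue_eq_of_continuousAt]
  · exact hb 1 ⟨one_pos, le_rfl⟩ θ hθ
  · exact (hasDerivAt_log_one_div_one_sub_sq (by simp) (by simpa [circleMap] using hθ)).continuousAt

/-! ### Failure of the Bloch condition -/

theorem log_one_div_one_sub_sq_notMem_blochSpace :
    (fun z : ℂ => Complex.log (1 / (1 - z)) ^ 2) ∉ blochSpace := by
  rintro ⟨-, M, hM⟩
  -- At `z = 1 - e^{-t}` the logarithm equals `t`, and the Bloch quantity is `(2 - d) * 2t > 2t >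
  -- M`.
  obtain ⟨t, ht⟩ : ∃ t, t = |M| + 1 := ⟨_, rfl⟩
  have ht1 : 1 ≤ t := by rw [ht]; linarith [abs_nonneg M]
  obtain ⟨d, hd⟩ : ∃ d, d = Real.exp (-t) := ⟨_, rfl⟩
  have hd0 : 0 < d := by rw [hd]; exact Real.exp_pos _
  have hd1 : d < 1 := by rw [hd]; exact Real.exp_lt_one_iff.mpr (by linarith)
  have hn : ‖((1 - d : ℝ) : ℂ)‖ = 1 - d := by
    rw [Complex.norm_real, Real.norm_of_nonneg (by linarith)]
  have hmem : ((1 - d : ℝ) : ℂ) ∈ unitDisc := by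
    rw [unitDisc, mem_ball_zero_iff, hn]
    linarith
  have hz := ne_one_of_mem_unitDisc hmem
  have h := hM (mem_image_of_mem _ hmem)
  have hlog : Complex.log (1 / (1 - ((1 - d : ℝ) : ℂ))) = (t : ℂ) := by
    have : (1 : ℂ) / (1 - ((1 - d : ℝ) : ℂ)) = ((Real.exp t : ℝ) : ℂ) := by
      rw [hd, Real.exp_neg]
      push_cast
      simp
    rw [this, ← Complex.ofReal_log (Real.exp_pos t).le, Real.log_exp]
  simp only [(hasDerivAt_log_one_div_one_sub_sq hz.1 hz.2).deriv, hlog, hn] at h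
  have hnorm : ‖2 * (t : ℂ) / (1 - ((1 - d : ℝ) : ℂ))‖ = 2 * t / d := by
    rw [show (2 * (t : ℂ) / (1 - ((1 - d : ℝ) : ℂ))) = ((2 * t / d : ℝ) : ℂ) by push_cast; ring,
      Complex.norm_real, Real.norm_of_nonneg (by positivity)]
  rw [hnorm] at h
  have heq : (1 - (1 - d) ^ 2) * (2 * t / d) = (2 - d) * (2 * t) := by
    field_simp
    ring
  rw [heq] at h
  have : M ≤ |M| := le_abs_self M
  nlinarith

theorem mainTheorem11 (lam : ℝ) (hlam0 : 0 < lam) (hlam1 : lam < 1) :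
    ¬ (analyticMorrey lam ⊆ blochSpace) ∧
      (fun z : ℂ => Complex.log (1 / (1 - z)) ^ 2) ∈ analyticMorrey lam ∧
      (fun z : ℂ => Complex.log (1 / (1 - z)) ^ 2) ∉ blochSpace :=
  ⟨fun h => log_one_div_one_sub_sq_notMem_blochSpace
      (h (log_one_div_one_sub_sq_mem_analyticMorrey hlam0 hlam1)),
    log_one_div_one_sub_sq_mem_analyticMorrey hlam0 hlam1,
    log_one_div_one_sub_sq_notMem_blochSpace⟩
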